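/- A *distance labeling scheme* for a family $\mathcal G$ of graphs consists of an encoder, which assigns to every node $u$ of every $G\in\mathcal G$ a label $e_G(u)\in\{0,1\}^*$, and a decoder $d:\{0,1\}^*\times\{0,1\}^*\to\mathbb N\cup\{\infty\}$, which sees only two labels and not the graph. Its *size* is the maximum of $|e_G(u)|$ over all $G\in\mathcal G$ and all nodes $u$ of $G$. The scheme is *$r$-additive* if $$\mathrm{dist}_G(u,v)\le d(e_G(u),e_G(v))\le \mathrm{dist}_G(u,v)+r$$ for all $G\in\mathcal G$ and all nodes $u,v$ of $G$, where $\mathrm{dist}_G(u,v)=\infty$ if $u$ and $v$ lie in different components. **Theorem.** There are absolute constants $C$ and $k$ such that for every integer $n\ge 2$ and every real $r\ge 2$ the following hold. 1. If $r\le n$, there is an $r$-additive distance labeling scheme for the family of all unweighted undirected graphs on $n$ nodes of size at most $$C\cdot\frac{n}{r}\cdot\frac{\log^k(r\log n)}{\log n}.$$ 2. Without an upper bound on $r$, there is an $r$-additive distance labeling scheme for the family of all connected unweighted undirected graphs on $n$ nodes whose size satisfies the same bound. That is, the label size is $O\!\left(\frac{n}{r}\cdot\frac{\operatorname{polylog}(r\log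 n)}{\log n}\right)$. Here $\log$ is the natural logarithm. -/

import Mathlib

/-- An encoder/decoder pair for graphs on `n` nodes. The encoder gives every node of every graph a
bit string; the decoder sees two bit strings only and returns a natural number or `∞`. -/
structure LabelingScheme (n : ℕ) where
  /-- `enc G u` is the label of the node `u` of `G`. -/
  enc : SimpleGraph (Fin n) → Fin n → List Bool
  /-- The decoder, oblivious to the graph. -/
  dec : List Bool → List Bool → ℕ∞

namespace LabelingScheme

/-- The scheme is `r`-additive on the family `𝒢`: the decoder returns an upper bound on the
distance that exceeds it by at most `r`. Distances are `∞` between different components. -/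
def IsAdditive {n : ℕ} (S : LabelingScheme n) (r : ℝ) (𝒢 : Set (SimpleGraph (Fin n))) : Prop :=
  ∀ G ∈ 𝒢, ∀ u v : Fin n,
    G.edist u v ≤ S.dec (S.enc G u) (S.enc G v) ∧
      (S.dec (S.enc G u) (S.enc G v) : ENNReal) ≤ (G.edist u v : ENNReal) + ENNReal.ofReal r

/-- The maximum label size over all graphs of `𝒢` and all their nodes is at most `b` bits. -/
def SizeLE {n : ℕ} (S : LabelingScheme n) (b : ℝ) (𝒢 : Set (SimpleGraph (Fin n))) : Prop :=
  ∀ G ∈ 𝒢, ∀ u : Fin n, ((S.enc G u).length : ℝ) ≤ b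

end LabelingScheme

/-!
Every node `u` stores a set of hubs together with its distances to them, such that any two nodes
`u`, `v` share a hub lying within `r / 2` of a shortest path between them. The decoder returns the
shortest detour through a common hub.

The gain of a factor `log n` has two sources. First, number the nodes by their positions `T` on a
walk of length `< 2 n` through all of them. Then `dist u x + 2 * T x` increases with `T x`, so the
hubs and their distances are described by two sets of at most `s` integers below `5 n`; with
`s ≈ n / (r log n)` this takes only `s · log (n / s) ≈ s · log (r log n)` bits, not `s · log n`.
Secondly, put `w = r log n`, `β = n / w` and `ρ = ⌊r / 2⌋`. About `β` nodes meet every ball of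
radius `ρ` that has at least `w ^ 2` nodes, so only pairs joined by a shortest path all of whose
`ρ`-balls are small remain. Those at distance at most `j ρ` number at most `w ^ (2 j) ≤ β` per node
if `j ≈ log n / log w`. A greedy set of about `β · log² w` nodes meets the shortest paths of all but
`β ^ 2` of the pairs that are further apart, and the missed pairs are stored directly at one end. If
`log n < 8 log w`, then one set of hubs meeting all balls of radius `ρ` does for all nodes.

A disconnected graph is made connected by joining its components through representatives, which
keeps the distances within components; the label also records the representative. For `r ≥ n` and
connected graphs the constant decoder `n` suffices.
-/

section HittingSets

open Finset

theorem card_powerset_filter_card_le {α : Type*} (P : Finset α) (s : ℕ) {K : ℝ} (hK : 1 ≤ K) :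
    (#{A ∈ P.powerset | #A ≤ s} : ℝ) ≤ K ^ s * Real.exp (#P / K) := by
  have hK0 : 0 < K := zero_lt_one.trans_le hK
  have hterm : ∀ A : Finset α, #A ≤ s → 1 ≤ K ^ s * K⁻¹ ^ #A := fun A hA ↦ by
    rw [inv_pow, ← div_eq_mul_inv, one_le_div (pow_pos hK0 _)]
    exact pow_le_pow_right₀ hK hA
  calc (#{A ∈ P.powerset | #A ≤ s} : ℝ)
      ≤ ∑ A ∈ P.powerset with #A ≤ s, K ^ s * K⁻¹ ^ #A := by
        rw [← nsmul_one]
        exact card_nsmul_le_sum _ _ _ fun A hA ↦ hterm A (mem_filter.1 hA).2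
    _ ≤ ∑ A ∈ P.powerset, K ^ s * K⁻¹ ^ #A :=
        sum_le_sum_of_subset_of_nonneg (filter_subset _ _) fun _ _ _ ↦ by positivity
    _ = K ^ s * (K⁻¹ + 1) ^ #P := by
        rw [← mul_sum, ← sum_pow_mul_eq_add_pow]
        simp only [one_pow, mul_one]
    _ ≤ K ^ s * Real.exp K⁻¹ ^ #P := by
        gcongr
        exact Real.add_one_le_exp _
    _ = K ^ s * Real.exp (#P / K) := by rw [← Real.exp_nat_mul, div_eq_mul_inv]

theorem card_filter_lt_le_of_sum_le {ι : Type*} {s : Finset ι} {f : ι → ℕ} {a b : ℕ}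
    (hb : 0 < b) (h : ∑ i ∈ s, f i ≤ a * b) : #{i ∈ s | b < f i} ≤ a := by
  refine Nat.le_of_mul_le_mul_right (le_trans ?_ h) hb
  calc #{i ∈ s | b < f i} * b ≤ ∑ i ∈ s with b < f i, f i :=
        card_nsmul_le_sum _ _ _ fun i hi ↦ (mem_filter.1 hi).2.le
    _ ≤ ∑ i ∈ s, f i := sum_le_sum_of_subset (filter_subset _ _)

variable {V ι : Type*} [Fintype V] [Nonempty V] {I : Finset ι} {F : ι → Finset V} {D : ℕ}

theorem exists_card_mul_le_card_mul_card_filter_mem [DecidableEq V]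
    (hF : ∀ i ∈ I, D ≤ #(F i)) :
    ∃ x, #I * D ≤ Fintype.card V * #{i ∈ I | x ∈ F i} := by
  have hcount : ∑ x, #{i ∈ I | x ∈ F i} = ∑ i ∈ I, #(F i) := by
    simpa [bipartiteAbove, bipartiteBelow] using
      sum_card_bipartiteAbove_eq_sum_card_bipartiteBelow (s := univ) (t := I) fun x i ↦ x ∈ F i
  obtain ⟨x, -, hx⟩ : ∃ x ∈ (univ : Finset V),
      #I * D ≤ Fintype.card V * #{i ∈ I | x ∈ F i} := by
    refine exists_le_of_sum_le univ_nonempty ?_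
    rw [sum_const, smul_eq_mul, card_univ, ← mul_sum, hcount]
    exact Nat.mul_le_mul_left _ (card_nsmul_le_sum I _ D hF)
  exact ⟨x, hx⟩

-- Greedy choice: the best next point meets a `D / card V` fraction of the sets missed so far.
theorem exists_card_le_card_filter_disjoint_le [DecidableEq V]
    (hF : ∀ i ∈ I, D ≤ #(F i)) (k : ℕ) :
    ∃ S : Finset V, #S ≤ k ∧
      (#{i ∈ I | Disjoint (F i) S} : ℝ) ≤ #I * Real.exp (-(k * D / Fintype.card V)) := by
  have hV : (0 : ℝ) < Fintype.card V := by exact_mod_cast Fintype.card_pos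
  induction k with
  | zero => exact ⟨∅, by simp⟩
  | succ k ih =>
    obtain ⟨S, hS, hmiss⟩ := ih
    set J : Finset ι := {i ∈ I | Disjoint (F i) S}
    obtain ⟨x, hx⟩ := exists_card_mul_le_card_mul_card_filter_mem (I := J)
      fun i hi ↦ hF i (mem_filter.1 hi).1
    have hinsert : ({i ∈ I | Disjoint (F i) (insert x S)} : Finset ι) = {i ∈ J | x ∉ F i} := by
      simp only [J, filter_filter, disjoint_insert_right, and_comm]
    have hsplit : (#{i ∈ J | x ∈ F i} : ℝ) + #{i ∈ J | x ∉ F i} = #J := by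
      exact_mod_cast card_filter_add_card_filter_not (s := J) (x ∈ F ·)
    have hgain : #J * (D / Fintype.card V : ℝ) ≤ #{i ∈ J | x ∈ F i} := by
      rw [← mul_div_assoc, div_le_iff₀' hV]
      exact_mod_cast hx
    refine ⟨insert x S, (card_insert_le _ _).trans (by lia), ?_⟩
    calc (#{i ∈ I | Disjoint (F i) (insert x S)} : ℝ)
        ≤ #J * (1 - D / Fintype.card V) := by rw [hinsert]; linarith
      _ ≤ #J * Real.exp (-(D / Fintype.card V)) := by
          gcongr
          exact Real.one_sub_le_exp_neg _
      _ ≤ #I * Real.exp (-(k * D / Fintype.card V)) * Real.exp (-(D / Fintype.card V)) := by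
          gcongr
      _ = #I * Real.exp (-((k + 1 : ℕ) * D / Fintype.card V)) := by
          rw [mul_assoc, ← Real.exp_add]
          congr 2
          push_cast
          ring

theorem exists_card_le_forall_not_disjoint (hF : ∀ i ∈ I, D ≤ #(F i)) {k : ℕ}
    (hk : Fintype.card V * Real.log #I < k * D) :
    ∃ S : Finset V, #S ≤ k ∧ ∀ i ∈ I, ¬Disjoint (F i) S := by
  classical
  obtain ⟨S, hS, hmiss⟩ := exists_card_le_card_filter_disjoint_le hF k
  refine ⟨S, hS, ?_⟩
  obtain rfl | hI := I.eq_empty_or_nonempty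
  · simp only [notMem_empty, false_imp_iff, implies_true]
  have hV : (0 : ℝ) < Fintype.card V := by exact_mod_cast Fintype.card_pos
  have hI0 : (0 : ℝ) < #I := by exact_mod_cast hI.card_pos
  have hlt : #I * Real.exp (-(k * D / Fintype.card V)) < 1 := by
    rw [Real.exp_neg, ← div_eq_mul_inv, div_lt_one (Real.exp_pos _), ← Real.log_lt_iff_lt_exp hI0,
      lt_div_iff₀' hV]
    exact hk
  have hnone : #{i ∈ I | Disjoint (F i) S} = 0 :=
    Nat.lt_one_iff.1 (by exact_mod_cast hmiss.trans_lt hlt)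
  simpa [filter_eq_empty_iff] using hnone

end HittingSets

section Walks

open SimpleGraph Finset

variable {V : Type*} {G : SimpleGraph V}

theorem dist_getVert_le {a b : V} (w : G.Walk a b) (i k : ℕ) :
    G.dist (w.getVert i) (w.getVert (i + k)) ≤ k := by
  have h := dist_le ((w.drop i).take k)
  rw [Walk.take_length, Walk.drop_getVert] at h
  exact h.trans (min_le_left _ _)

theorem exists_dist_eq_and_dist_add_eq (hG : G.Connected) {u v : V} {t : ℕ}
    (ht : t ≤ G.dist u v) : ∃ x, G.dist u x = t ∧ t + G.dist x v = G.dist u v := by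
  obtain ⟨p, hp⟩ := hG.exists_walk_length_eq_dist u v
  have hut := dist_getVert_le p 0 t
  have htv := dist_getVert_le p t (p.length - t)
  rw [Walk.getVert_zero, zero_add] at hut
  rw [Nat.add_sub_cancel' (by lia), Walk.getVert_length] at htv
  have := hG.dist_triangle (u := u) (v := p.getVert t) (w := v)
  exact ⟨p.getVert t, by lia, by lia⟩

theorem dist_lt_card [Fintype V] (hG : G.Connected) (u v : V) :
    G.dist u v < Fintype.card V := by
  obtain ⟨p, hp, hlen⟩ := hG.exists_path_of_dist u v
  exact hlen ▸ hp.length_lt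

theorem exists_walk_cons_support_subset (hG : G.Connected) {a b z : V} (w : G.Walk a b)
    (hz : z ∉ w.support) :
    ∃ y ∉ w.support, ∃ w' : G.Walk a b,
      w'.length = w.length + 2 ∧ y :: w.support ⊆ w'.support := by
  classical
  obtain ⟨p⟩ := hG a z
  obtain ⟨d, -, hfst, hsnd⟩ := p.exists_boundary_dart {x | x ∈ w.support} (by simp) hz
  have hx : d.fst ∈ w.support := hfst
  have hlen := congrArg Walk.length (w.take_spec hx)
  have hsupp := congrArg Walk.support (w.take_spec hx)
  refine ⟨d.snd, hsnd, (w.takeUntil d.fst hx).append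
    (.cons d.adj (.cons d.adj.symm (w.dropUntil d.fst hx))), ?_, ?_⟩
  · simp only [Walk.length_append, Walk.length_cons] at hlen ⊢
    lia
  · intro y hy
    rw [List.mem_cons, ← hsupp, Walk.mem_support_append_iff] at hy
    simp only [Walk.mem_support_append_iff, Walk.support_cons, List.mem_cons]
    tauto

variable [Fintype V]

theorem exists_walk_length_le_two_mul_lt_card_support [DecidableEq V] (hG : G.Connected) {m : ℕ}
    (hm : m < Fintype.card V) :
    ∃ (a b : V) (w : G.Walk a b), w.length ≤ 2 * m ∧ m < #w.support.toFinset := by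
  induction m with
  | zero =>
    obtain ⟨a⟩ := hG.nonempty
    exact ⟨a, a, .nil, by simp⟩
  | succ m ih =>
    obtain ⟨a, b, w, hlen, hcard⟩ := ih (by lia)
    by_cases hw : m + 1 < #w.support.toFinset
    · exact ⟨a, b, w, by lia, hw⟩
    obtain ⟨z, hz⟩ : ∃ z, z ∉ w.support.toFinset :=
      (exists_mem_notMem_of_card_lt_card (s := w.support.toFinset) (t := univ)
        (by rw [card_univ]; lia)).imp fun _ ↦ And.right
    rw [List.mem_toFinset] at hz
    obtain ⟨y, hy, w', hlen', hsub⟩ := exists_walk_cons_support_subset hG w hz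
    refine ⟨a, b, w', by lia, ?_⟩
    have hcard' : #(y :: w.support).toFinset ≤ #w'.support.toFinset :=
      card_le_card fun x hx ↦ List.mem_toFinset.2 (hsub (List.mem_toFinset.1 hx))
    rw [List.toFinset_cons, card_insert_of_notMem (by simpa using hy)] at hcard'
    lia

theorem exists_walk_length_lt_two_mul_card (hG : G.Connected) :
    ∃ (a b : V) (w : G.Walk a b), w.length < 2 * Fintype.card V ∧ ∀ v, v ∈ w.support := by
  classical
  have hV : 0 < Fintype.card V := Fintype.card_pos_iff.2 hG.nonempty
  obtain ⟨a, b, w, hlen, hcard⟩ :=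
    exists_walk_length_le_two_mul_lt_card_support hG (Nat.sub_lt hV one_pos)
  have huniv : w.support.toFinset = univ :=
    eq_univ_of_card _ (le_antisymm (card_le_univ _) (by lia))
  exact ⟨a, b, w, by lia, fun v ↦ List.mem_toFinset.1 (huniv ▸ mem_univ v)⟩

end Walks

section Positions

open SimpleGraph

variable {V : Type*} {G : SimpleGraph V} {T : V → ℕ}

/-- `T` places the nodes of `G` on a line so that the distance between two nodes is at most the
difference of their positions. Such positions are read off a walk through all nodes, and they
encode a set of nodes together with the distances to it by two sets of integers. -/
def IsPosition (G : SimpleGraph V) (T : V → ℕ) : Prop :=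
  ∀ u v, T u ≤ T v → T u + G.dist u v ≤ T v

theorem exists_isPosition [Fintype V] (hG : G.Connected) :
    ∃ T, IsPosition G T ∧ ∀ v, T v < 2 * Fintype.card V := by
  obtain ⟨a, b, w, hlen, hw⟩ := exists_walk_length_lt_two_mul_card hG
  choose T hT hTlen using fun v ↦ Walk.mem_support_iff_exists_getVert.1 (hw v)
  refine ⟨T, fun u v huv ↦ ?_, fun v ↦ (hTlen v).trans_lt hlen⟩
  have h := dist_getVert_le w (T u) (T v - T u)
  rw [Nat.add_sub_cancel' huv, hT, hT] at h
  lia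

theorem IsPosition.injective (hT : IsPosition G T) (hG : G.Connected) : T.Injective :=
  fun u v huv ↦ hG.dist_eq_zero_iff.1 (by have := hT u v huv.le; lia)

-- `dist u x + T x` is only weakly increasing along `T`; the factor `2` makes it strict.
theorem IsPosition.dist_add_lt_dist_add_iff (hT : IsPosition G T) (hG : G.Connected) (u : V)
    {x y : V} : G.dist u x + 2 * T x < G.dist u y + 2 * T y ↔ T x < T y := by
  have hxy := hG.dist_triangle (u := u) (v := y) (w := x)
  have hyx := hG.dist_triangle (u := u) (v := x) (w := y)
  rw [G.dist_comm (u := y)] at hxy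
  constructor
  · contrapose!
    intro h
    have := hT y x h
    rw [G.dist_comm] at this
    lia
  · intro h
    have := hT x y h.le
    lia

end Positions

section HubFamilies

open SimpleGraph Finset

variable {V : Type*} {G : SimpleGraph V}

/-- `Y` assigns to every node a finite set of hubs such that any two nodes `u` and `v` have a
common hub `x` for which the detour from `u` to `v` through `x` is at most `R` longer than the
distance. -/
def IsHubFamily (G : SimpleGraph V) (R : ℕ) (Y : V → Finset V) : Prop :=
  ∀ u v, ∃ x ∈ Y u, x ∈ Y v ∧ G.dist u x + G.dist x v ≤ G.dist u v + R

variable [Fintype V]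

/-- The nodes on shortest walks from `u` to `v`, in a connected graph. -/
noncomputable def geodesicInterval (G : SimpleGraph V) (u v : V) : Finset V :=
  {x | G.dist u x + G.dist x v = G.dist u v}

/-- The nodes at distance at most `ρ` from `u`, in a connected graph: the closed ball, as opposed
to the open `SimpleGraph.ball`. -/
noncomputable def closedBallFinset (G : SimpleGraph V) (ρ : ℕ) (u : V) : Finset V :=
  {x | G.dist u x ≤ ρ}

theorem mem_geodesicInterval {u v x : V} :
    x ∈ geodesicInterval G u v ↔ G.dist u x + G.dist x v = G.dist u v := by
  simp only [geodesicInterval, mem_filter_univ]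

theorem mem_closedBallFinset {ρ : ℕ} {u x : V} : x ∈ closedBallFinset G ρ u ↔ G.dist u x ≤ ρ := by
  simp only [closedBallFinset, mem_filter_univ]

theorem left_mem_geodesicInterval (u v : V) : u ∈ geodesicInterval G u v := by
  simp only [mem_geodesicInterval, dist_self, zero_add]

theorem geodesicInterval_subset_left (hG : G.Connected) {u v x : V}
    (hx : x ∈ geodesicInterval G u v) : geodesicInterval G u x ⊆ geodesicInterval G u v := by
  intro y hy
  rw [mem_geodesicInterval] at *
  have := hG.dist_triangle (u := y) (v := x) (w := v)
  have := hG.dist_triangle (u := u) (v := y) (w := v)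
  lia

theorem dist_add_dist_le_add_two_mul (hG : G.Connected) {ρ : ℕ} {u v x y : V}
    (hx : x ∈ geodesicInterval G u v) (hy : y ∈ closedBallFinset G ρ x) :
    G.dist u y + G.dist y v ≤ G.dist u v + 2 * ρ := by
  rw [mem_geodesicInterval] at hx
  rw [mem_closedBallFinset] at hy
  have huy := hG.dist_triangle (u := u) (v := x) (w := y)
  have hyv := hG.dist_triangle (u := y) (v := x) (w := v)
  rw [G.dist_comm (u := y) (v := x)] at hyv
  lia

theorem dist_le_card_geodesicInterval (hG : G.Connected) (u v : V) :
    G.dist u v ≤ #(geodesicInterval G u v) := by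
  rw [← card_range (G.dist u v)]
  refine card_le_card_of_surjOn (G.dist u) fun t ht ↦ ?_
  obtain ⟨x, hux, hxv⟩ := exists_dist_eq_and_dist_add_eq hG (mem_range.1 ht).le
  exact ⟨x, by rwa [mem_coe, mem_geodesicInterval, hux], hux⟩

theorem lt_card_closedBallFinset (hG : G.Connected) {ρ : ℕ} (hρ : ρ < Fintype.card V) (u : V) :
    ρ < #(closedBallFinset G ρ u) := by
  by_cases h : ∀ v, G.dist u v ≤ ρ
  · simpa only [closedBallFinset, h, filter_true, card_univ] using hρ
  · push Not at h
    obtain ⟨v, hv⟩ := h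
    rw [← Nat.add_one_le_iff, ← card_range (ρ + 1)]
    refine card_le_card_of_surjOn (G.dist u) fun t ht ↦ ?_
    have htρ : t ≤ ρ := Nat.lt_succ_iff.1 (mem_range.1 ht)
    obtain ⟨x, hux, -⟩ := exists_dist_eq_and_dist_add_eq hG (htρ.trans hv.le)
    exact ⟨x, by rwa [mem_coe, mem_closedBallFinset, hux], hux⟩

theorem exists_hitting_closedBalls (hG : G.Connected) (ρ : ℕ) {M a : ℕ}
    (ha : Fintype.card V * Real.log (Fintype.card V) < a * M) :
    ∃ A : Finset V, #A ≤ a ∧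
      ∀ x, M ≤ #(closedBallFinset G ρ x) → ¬Disjoint (closedBallFinset G ρ x) A := by
  have := hG.nonempty
  let large : Finset V := {x | M ≤ #(closedBallFinset G ρ x)}
  have hlarge : Real.log #large ≤ Real.log (Fintype.card V) := by
    obtain h | h := Nat.eq_zero_or_pos #large
    · rw [h, Nat.cast_zero, Real.log_zero]
      exact Real.log_natCast_nonneg _
    · exact Real.log_le_log (by exact_mod_cast h) (by exact_mod_cast card_le_univ large)
  obtain ⟨A, hA, hhit⟩ := exists_card_le_forall_not_disjoint (I := large)
    (F := closedBallFinset G ρ) (fun x hx ↦ (mem_filter_univ x).1 hx)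
    ((mul_le_mul_of_nonneg_left hlarge (Nat.cast_nonneg _)).trans_lt ha)
  exact ⟨A, hA, fun x hx ↦ hhit x ((mem_filter_univ x).2 hx)⟩

theorem exists_isHubFamily_of_lt_mul (hG : G.Connected) {ρ a : ℕ} (hρ : ρ < Fintype.card V)
    (ha : Fintype.card V * Real.log (Fintype.card V) < a * (ρ + 1 : ℕ)) :
    ∃ Y, IsHubFamily G (2 * ρ) Y ∧ ∀ u, #(Y u) ≤ a := by
  classical
  obtain ⟨A, hA, hhit⟩ := exists_hitting_closedBalls hG ρ ha
  refine ⟨fun _ ↦ A, fun u v ↦ ?_, fun _ ↦ hA⟩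
  obtain ⟨y, hy, hyA⟩ := not_disjoint_iff.1 (hhit u (lt_card_closedBallFinset hG hρ u))
  exact ⟨y, hyA, hyA, dist_add_dist_le_add_two_mul hG (left_mem_geodesicInterval u v) hy⟩

theorem exists_card_le_pow_of_card_closedBallFinset_le (hG : G.Connected) (ρ M : ℕ) (u : V)
    (j : ℕ) :
    ∃ Z : Finset V, #Z ≤ M ^ j ∧ ∀ v, G.dist u v ≤ j * ρ →
      (∀ x ∈ geodesicInterval G u v, #(closedBallFinset G ρ x) ≤ M) → v ∈ Z := by
  classical
  induction j with
  | zero =>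
    refine ⟨{u}, by simp, fun v huv _ ↦ ?_⟩
    rw [zero_mul, Nat.le_zero, hG.dist_eq_zero_iff] at huv
    exact mem_singleton.2 huv.symm
  | succ j ih =>
    obtain ⟨Z, hZ, hmem⟩ := ih
    refine ⟨{x ∈ Z | #(closedBallFinset G ρ x) ≤ M}.biUnion (closedBallFinset G ρ), ?_,
      fun v huv hsmall ↦ ?_⟩
    · rw [pow_succ]
      refine (card_biUnion_le_card_mul _ _ M fun x hx ↦ (mem_filter.1 hx).2).trans ?_
      exact Nat.mul_le_mul_right _ ((card_filter_le _ _).trans hZ)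
    · rw [add_one_mul] at huv
      obtain ⟨x, hux, hxv⟩ := exists_dist_eq_and_dist_add_eq hG (Nat.sub_le (G.dist u v) ρ)
      have hx : x ∈ geodesicInterval G u v := by rw [mem_geodesicInterval]; lia
      refine mem_biUnion.2 ⟨x, mem_filter.2 ⟨hmem x (by lia) fun y hy ↦ ?_, hsmall x hx⟩, ?_⟩
      · exact hsmall y (geodesicInterval_subset_left hG hx hy)
      · rw [mem_closedBallFinset]
        lia

theorem exists_sum_card_disjoint_geodesicInterval_le [DecidableEq V] (hG : G.Connected)
    {D k q : ℕ} (hq : 0 < q)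
    (hk : 2 * Fintype.card V * Real.log (Fintype.card V / q) ≤ k * D) :
    ∃ S : Finset V, #S ≤ k ∧
      ∑ u, #{v | D ≤ G.dist u v ∧ Disjoint (geodesicInterval G u v) S} ≤ q * q := by
  have := hG.nonempty
  have hV : (0 : ℝ) < Fintype.card V := by exact_mod_cast Fintype.card_pos
  have : (0 : ℝ) < q := by exact_mod_cast hq
  let far : Finset (V × V) := {p | D ≤ G.dist p.1 p.2}
  obtain ⟨S, hS, hmiss⟩ := exists_card_le_card_filter_disjoint_le (I := far)
    (F := fun p ↦ geodesicInterval G p.1 p.2)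
    (fun p hp ↦ (mem_filter.1 hp).2.trans (dist_le_card_geodesicInterval hG p.1 p.2)) k
  refine ⟨S, hS, ?_⟩
  have hsum : ∑ u, #{v | D ≤ G.dist u v ∧ Disjoint (geodesicInterval G u v) S} =
      #{p ∈ far | Disjoint (geodesicInterval G p.1 p.2) S} := by
    simp only [far, filter_filter, card_filter, Fintype.sum_prod_type]
  have hfar : (#far : ℝ) ≤ Fintype.card V ^ 2 := by
    rw [sq, ← Nat.cast_mul, ← Fintype.card_prod]
    exact_mod_cast card_le_univ far
  have hexp : Real.exp (-(k * D / Fintype.card V)) ≤ (q / Fintype.card V : ℝ) ^ 2 := by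
    rw [← Real.le_log_iff_exp_le (by positivity), Real.log_pow, ← inv_div (Fintype.card V : ℝ) q,
      Real.log_inv, Nat.cast_ofNat, mul_neg, neg_le_neg_iff, le_div_iff₀' hV]
    linarith
  have hle := hmiss.trans (mul_le_mul hfar hexp (Real.exp_pos _).le (by positivity))
  rw [← hsum, div_pow, mul_div_cancel₀ _ (by positivity), sq] at hle
  exact_mod_cast hle

-- Nodes with more than `q` unhit partners are few, and become hubs themselves.
theorem exists_hitting_geodesicIntervals (hG : G.Connected) {D k q : ℕ} (hq : 0 < q)
    (hk : 2 * Fintype.card V * Real.log (Fintype.card V / q) ≤ k * D) :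
    ∃ (S : Finset V) (X : V → Finset V), #S ≤ k + q ∧ (∀ u, #(X u) ≤ q) ∧
      ∀ u v, D ≤ G.dist u v → v ∈ X u ∨ ¬Disjoint (geodesicInterval G u v) S := by
  classical
  obtain ⟨S, hS, hmissed⟩ := exists_sum_card_disjoint_geodesicInterval_le hG hq hk
  let missed (u : V) : Finset V := {v | D ≤ G.dist u v ∧ Disjoint (geodesicInterval G u v) S}
  let bad : Finset V := {u | q < #(missed u)}
  have hbad : #bad ≤ q := card_filter_lt_le_of_sum_le hq hmissed
  refine ⟨S ∪ bad, fun u ↦ if u ∈ bad then ∅ else missed u, (card_union_le _ _).trans (by lia),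
    fun u ↦ ?_, fun u v huv ↦ ?_⟩
  · beta_reduce
    split_ifs with hu
    · exact Nat.zero_le _
    · simpa [bad] using hu
  · by_cases hu : u ∈ bad
    · exact .inr (not_disjoint_iff.2 ⟨u, left_mem_geodesicInterval u v, mem_union_right _ hu⟩)
    · by_cases hS : Disjoint (geodesicInterval G u v) S
      · exact .inl (by simp [hu, missed, huv, hS])
      · exact .inr fun h ↦ hS (disjoint_of_subset_right subset_union_left h)

theorem exists_isHubFamily (hG : G.Connected) {ρ M j a k q : ℕ} (hq : 0 < q)
    (ha : Fintype.card V * Real.log (Fintype.card V) < a * M)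
    (hk : 2 * Fintype.card V * Real.log (Fintype.card V / q) ≤ k * (j * ρ : ℕ)) :
    ∃ Y, IsHubFamily G (2 * ρ) Y ∧ ∀ u, #(Y u) ≤ 1 + (k + q) + q + a + M ^ j := by
  classical
  obtain ⟨A, hA, hAhit⟩ := exists_hitting_closedBalls hG ρ ha
  obtain ⟨S, X, hS, hX, hSX⟩ := exists_hitting_geodesicIntervals hG hq hk
  choose Z hZ hmemZ using fun u ↦ exists_card_le_pow_of_card_closedBallFinset_le hG ρ M u j
  refine ⟨fun u ↦ {u} ∪ S ∪ X u ∪ A ∪ Z u, fun u v ↦ ?_, fun u ↦ ?_⟩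
  · by_cases hfar : j * ρ ≤ G.dist u v
    · obtain hv | hx := hSX u v hfar
      · exact ⟨v, by simp [hv], by simp, by simp⟩
      · obtain ⟨x, hx, hxS⟩ := not_disjoint_iff.1 hx
        exact ⟨x, by simp [hxS], by simp [hxS],
          (mem_geodesicInterval.1 hx).trans_le (Nat.le_add_right _ _)⟩
    by_cases hsmall : ∀ x ∈ geodesicInterval G u v, #(closedBallFinset G ρ x) ≤ M
    · exact ⟨v, by simp [hmemZ u v (not_le.1 hfar).le hsmall], by simp, by simp⟩
    · push Not at hsmall
      obtain ⟨x, hx, hlarge⟩ := hsmall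
      obtain ⟨y, hy, hyA⟩ := not_disjoint_iff.1 (hAhit x hlarge.le)
      exact ⟨y, by simp [hyA], by simp [hyA], dist_add_dist_le_add_two_mul hG hx hy⟩
  · refine (card_union_le _ _).trans (Nat.add_le_add ?_ (hZ u))
    refine (card_union_le _ _).trans (Nat.add_le_add ?_ hA)
    refine (card_union_le _ _).trans (Nat.add_le_add ?_ (hX u))
    exact (card_union_le _ _).trans (Nat.add_le_add (card_singleton u).le hS)

end HubFamilies

section HubCodes

open SimpleGraph Finset

variable {V : Type*}

/-- `e` labels the nodes of `G` in such a way that the decoder `dec` recovers the distances from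
the labels up to an overestimate of at most `R`. This is a distance labeling scheme for the single
graph `G`, with labels of an arbitrary type `X`. -/
def IsDistLabeling {X : Type*} (G : SimpleGraph V) (R : ℕ) (dec : X → X → ℕ∞) (e : V → X) :
    Prop :=
  ∀ u v, G.edist u v ≤ dec (e u) (e v) ∧ dec (e u) (e v) ≤ G.edist u v + R

/-- The code of the restriction to `Y` of a function `f` for which `f + 2 * T` increases with `T`:
the elements of the two sets correspond to each other in increasing order. -/
def hubCode (T f : V → ℕ) (Y : Finset V) : Finset ℕ × Finset ℕ :=
  (Y.image T, Y.image fun x ↦ f x + 2 * T x)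

/-- The value encoded by `p` at the position `t`. -/
noncomputable def hubValue (p : Finset ℕ × Finset ℕ) (t : ℕ) : ℕ :=
  Nat.nth (· ∈ p.2) (Nat.count (· ∈ p.1) t) - 2 * t

/-- The decoder of hub codes: the least sum of the two values at a common position. -/
noncomputable def hubDec (p q : Finset ℕ × Finset ℕ) : ℕ∞ :=
  ⨅ t ∈ p.1 ∩ q.1, ((hubValue p t + hubValue q t : ℕ) : ℕ∞)

/-- The possible codes of at most `s` hubs in a connected graph on `n` nodes. -/
def hubCodes (n s : ℕ) : Finset (Finset ℕ × Finset ℕ) :=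
  {A ∈ (range (5 * n)).powerset | #A ≤ s} ×ˢ {A ∈ (range (5 * n)).powerset | #A ≤ s}

theorem count_mem_image {g : V → ℕ} (hg : g.Injective) (Y : Finset V) (m : ℕ) :
    Nat.count (· ∈ Y.image g) m = #{y ∈ Y | g y < m} := by
  rw [Nat.count_eq_card_filter_range, ← card_image_of_injective _ hg]
  congr 1
  ext i
  simp only [mem_filter, mem_range, mem_image]
  aesop

theorem hubValue_hubCode {T f : V → ℕ} (hT : T.Injective)
    (hf : ∀ x y, f x + 2 * T x < f y + 2 * T y ↔ T x < T y) {Y : Finset V} {x : V} (hx : x ∈ Y) :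
    hubValue (hubCode T f Y) (T x) = f x := by
  have hinj : Function.Injective fun x ↦ f x + 2 * T x := fun y z hyz ↦
    hT (le_antisymm (not_lt.1 fun h ↦ ((hf z y).2 h).ne' hyz)
      (not_lt.1 fun h ↦ ((hf y z).2 h).ne hyz))
  have hrank : Nat.count (· ∈ Y.image T) (T x) =
      Nat.count (· ∈ Y.image fun x ↦ f x + 2 * T x) (f x + 2 * T x) := by
    simp only [count_mem_image hT, count_mem_image hinj, hf]
  have hnth := Nat.nth_count (p := (· ∈ Y.image fun x ↦ f x + 2 * T x))
    (mem_image_of_mem (fun x ↦ f x + 2 * T x) hx)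
  rw [hubValue, hubCode, hrank, hnth, Nat.add_sub_cancel]

variable {G : SimpleGraph V} {R : ℕ} {Y : V → Finset V}

theorem IsHubFamily.isDistLabeling (hY : IsHubFamily G R Y) (hG : G.Connected) {T : V → ℕ}
    (hT : IsPosition G T) :
    IsDistLabeling G R hubDec fun u ↦ hubCode T (G.dist u) (Y u) := by
  have hval (u x : V) (hx : x ∈ Y u) : hubValue (hubCode T (G.dist u) (Y u)) (T x) = G.dist u x :=
    hubValue_hubCode (hT.injective hG) (fun _ _ ↦ hT.dist_add_lt_dist_add_iff hG u) hx
  intro u v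
  rw [← (hG u v).coe_dist_eq_edist]
  constructor
  · refine le_iInf₂ fun t ht ↦ ?_
    obtain ⟨⟨x, hxu, rfl⟩, y, hyv, hyx⟩ := (mem_inter.1 ht).imp mem_image.1 mem_image.1
    obtain rfl := hT.injective hG hyx
    rw [hval u y hxu, hval v y hyv, G.dist_comm (u := v)]
    exact_mod_cast hG.dist_triangle
  · obtain ⟨x, hxu, hxv, hx⟩ := hY u v
    refine (iInf₂_le (T x) (mem_inter.2 ⟨mem_image_of_mem T hxu, mem_image_of_mem T hxv⟩)).trans ?_
    rw [hval u x hxu, hval v x hxv, G.dist_comm (u := v)]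
    exact_mod_cast hx

theorem hubCode_mem_hubCodes {T f : V → ℕ} {Y : Finset V} {n s : ℕ} (hT : ∀ x, T x < 2 * n)
    (hf : ∀ x, f x < n) (hY : #Y ≤ s) : hubCode T f Y ∈ hubCodes n s := by
  simp only [hubCode, hubCodes, mem_product, mem_filter, mem_powerset, image_subset_iff, mem_range]
  refine ⟨⟨fun x _ ↦ ?_, card_image_le.trans hY⟩, fun x _ ↦ ?_, card_image_le.trans hY⟩
  · have := hT x
    lia
  · have := hT x
    have := hf x
    lia

theorem IsHubFamily.exists_isDistLabeling [Fintype V] (hY : IsHubFamily G R Y) (hG : G.Connected)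
    {s : ℕ} (hs : ∀ u, #(Y u) ≤ s) :
    ∃ e, (∀ u, e u ∈ hubCodes (Fintype.card V) s) ∧ IsDistLabeling G R hubDec e := by
  obtain ⟨T, hT, hTlt⟩ := exists_isPosition hG
  exact ⟨_, fun u ↦ hubCode_mem_hubCodes hTlt (dist_lt_card hG u) (hs u),
    hY.isDistLabeling hG hT⟩

theorem card_hubCodes_le (n s : ℕ) {K : ℝ} (hK : 1 ≤ K) :
    (#(hubCodes n s) : ℝ) ≤ K ^ (2 * s) * Real.exp (10 * n / K) := by
  have h := card_powerset_filter_card_le (range (5 * n)) s hK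
  rw [card_range] at h
  calc (#(hubCodes n s) : ℝ)
      ≤ (K ^ s * Real.exp ((5 * n : ℕ) / K)) * (K ^ s * Real.exp ((5 * n : ℕ) / K)) := by
        rw [hubCodes, card_product, Nat.cast_mul]
        exact mul_le_mul h h (Nat.cast_nonneg _) ((Nat.cast_nonneg _).trans h)
    _ = K ^ (2 * s) * Real.exp (10 * n / K) := by
        rw [mul_mul_mul_comm, ← pow_add, ← two_mul, ← Real.exp_add]
        push_cast
        ring_nf

end HubCodes

section Components

open SimpleGraph

variable {V : Type*}

/-- A chosen node of the connected component of `u`. -/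
noncomputable def componentRep (G : SimpleGraph V) (u : V) : V :=
  (G.connectedComponentMk u).out

/-- The connected graph obtained from `G` by adding all edges between the chosen nodes of its
components. It has the distances of `G` within each component. -/
noncomputable def joinComponents (G : SimpleGraph V) : SimpleGraph V :=
  G ⊔ (⊤ : SimpleGraph G.ConnectedComponent).map Quot.out

theorem reachable_componentRep (G : SimpleGraph V) (u : V) : G.Reachable u (componentRep G u) :=
  ConnectedComponent.exact (Quot.out_eq (G.connectedComponentMk u)).symm

theorem componentRep_eq_iff {G : SimpleGraph V} {u v : V} :
    componentRep G u = componentRep G v ↔ G.Reachable u v :=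
  (Function.LeftInverse.injective Quot.out_eq).eq_iff.trans ConnectedComponent.eq

theorem joinComponents_connected [Nonempty V] (G : SimpleGraph V) :
    (joinComponents G).Connected := by
  refine ⟨fun u v ↦ ?_⟩
  have hrep (w : V) : (joinComponents G).Reachable w (componentRep G w) :=
    (reachable_componentRep G w).mono le_sup_left
  refine ((hrep u).trans ?_).trans (hrep v).symm
  by_cases huv : componentRep G u = componentRep G v
  · rw [huv]
  · exact Adj.reachable (.inr ⟨huv, _, _, fun h ↦ huv (congrArg Quot.out h), rfl, rfl⟩)

theorem edist_map_le {W : Type*} {G : SimpleGraph V} {H : SimpleGraph W} {f : V → W}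
    (hf : ∀ x y, G.Adj x y → H.edist (f x) (f y) ≤ 1) (u v : V) :
    H.edist (f u) (f v) ≤ G.edist u v := by
  refine le_iInf fun w ↦ ?_
  induction w with
  | nil => simp
  | cons hxy w ih =>
    rw [Walk.length_cons, Nat.cast_add, Nat.cast_one, add_comm]
    exact SimpleGraph.edist_triangle.trans (add_le_add (hf _ _ hxy) ih)

-- Collapsing every other component to the chosen node of the component of `u` is a retraction.
theorem edist_joinComponents {G : SimpleGraph V} {u v : V} (h : G.Reachable u v) :
    (joinComponents G).edist u v = G.edist u v := by
  classical
  refine le_antisymm (edist_anti le_sup_left) ?_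
  let f (x : V) : V := if G.Reachable u x then x else componentRep G u
  have hf (C : G.ConnectedComponent) : f C.out = componentRep G u := by
    by_cases hr : G.Reachable u C.out
    · have hC : C = G.connectedComponentMk u :=
        (Quot.out_eq C).symm.trans (ConnectedComponent.sound hr.symm)
      exact (if_pos hr).trans (congrArg Quot.out hC)
    · exact if_neg hr
  have hstep (x y : V) (hxy : (joinComponents G).Adj x y) : G.edist (f x) (f y) ≤ 1 := by
    rw [edist_le_one_iff_adj_or_eq]
    obtain hxy | ⟨-, C, D, -, rfl, rfl⟩ := hxy
    · by_cases hx : G.Reachable u x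
      · left
        simpa only [f, if_pos hx, if_pos (hx.trans hxy.reachable)]
      · right
        have hy : ¬G.Reachable u y := fun hy ↦ hx (hy.trans hxy.symm.reachable)
        simp only [f, if_neg hx, if_neg hy]
    · exact .inr ((hf C).trans (hf D).symm)
  simpa only [f, Reachable.rfl, h, if_true] using edist_map_le hstep u v

theorem isDistLabeling_componentRep {X : Type*} {G : SimpleGraph V} {R : ℕ} {dec : X → X → ℕ∞}
    {e : V → X} [DecidableEq V] (he : IsDistLabeling (joinComponents G) R dec e) :
    IsDistLabeling G R (fun p q ↦ if p.2 = q.2 then dec p.1 q.1 else ⊤)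
      fun u ↦ (e u, componentRep G u) := by
  intro u v
  by_cases huv : G.Reachable u v
  · simpa only [componentRep_eq_iff, huv, if_true, edist_joinComponents huv] using he u v
  · simp only [componentRep_eq_iff, huv, if_false, edist_eq_top_of_not_reachable huv, le_refl,
      top_add, and_self]

end Components

section LabelingSchemes

open SimpleGraph Finset

theorem toENNReal_le_add_ofReal {a d : ℕ∞} {R : ℕ} {r : ℝ} (hr : R ≤ r) (h : a ≤ d + R) :
    (a : ENNReal) ≤ (d : ENNReal) + ENNReal.ofReal r :=
  calc (a : ENNReal) ≤ ((d + R : ℕ∞) : ENNReal) := ENat.toENNReal_le.2 h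
    _ = (d : ENNReal) + ENNReal.ofReal R := by simp
    _ ≤ (d : ENNReal) + ENNReal.ofReal r := by gcongr

theorem LabelingScheme.exists_isAdditive_sizeLE {n R b : ℕ} {r B : ℝ} {X : Type*}
    {𝒢 : Set (SimpleGraph (Fin n))} {F : Finset X} {dec : X → X → ℕ∞} (hF : #F ≤ 2 ^ b)
    (hb : b ≤ B) (hr : R ≤ r)
    (h : ∀ G ∈ 𝒢, ∃ e, (∀ u, e u ∈ F) ∧ IsDistLabeling G R dec e) :
    ∃ S : LabelingScheme n, S.IsAdditive r 𝒢 ∧ S.SizeLE B 𝒢 := by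
  classical
  choose e heF he using h
  obtain ⟨φ⟩ : Nonempty (F ↪ (Fin b → Bool)) :=
    Function.Embedding.nonempty_of_card_le (by simpa using hF)
  let code (x : F) : List Bool := List.ofFn (φ x)
  have hcode : code.Injective := List.ofFn_injective.comp φ.injective
  let S : LabelingScheme n :=
    { enc G u := if hG : G ∈ 𝒢 then code ⟨e G hG u, heF G hG u⟩ else []
      dec l l' := Function.extend (Prod.map code code) (fun p ↦ dec p.1 p.2) ⊤ (l, l') }
  have hdec (x y : F) : S.dec (code x) (code y) = dec x y :=
    (hcode.prodMap hcode).extend_apply (fun p ↦ dec p.1 p.2) ⊤ (x, y)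
  refine ⟨S, fun G hG u v ↦ ?_, fun G hG u ↦ ?_⟩
  · simp only [S, dif_pos hG] at hdec ⊢
    rw [hdec]
    exact ⟨(he G hG u v).1, toENNReal_le_add_ofReal hr (he G hG u v).2⟩
  · simpa [S, dif_pos hG, code] using hb

theorem isDistLabeling_const_card {V : Type*} [Fintype V] {G : SimpleGraph V}
    (hG : G.Connected) :
    IsDistLabeling G (Fintype.card V) (fun _ _ ↦ Fintype.card V) fun _ ↦ () := by
  intro u v
  rw [← (hG u v).coe_dist_eq_edist]
  exact ⟨Nat.cast_le.2 (dist_lt_card hG u v).le, le_add_self⟩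

theorem LabelingScheme.exists_isAdditive_connected_of_le {n : ℕ} {r B : ℝ} (hr : n ≤ r)
    (hB : 0 ≤ B) :
    ∃ S : LabelingScheme n, S.IsAdditive r {G | G.Connected} ∧ S.SizeLE B {G | G.Connected} :=
  exists_isAdditive_sizeLE (F := {()}) (R := Fintype.card (Fin n)) (b := 0) le_rfl
    (by simpa using hB) (by simpa using hr) fun _ hG ↦
    ⟨_, fun _ ↦ mem_singleton_self _, isDistLabeling_const_card hG⟩

end LabelingSchemes

section Parameters

open SimpleGraph Finset

/-- The quantity `log (r log n)` that measures the polylogarithmic factor of the label size. -/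
noncomputable def logFactor (n : ℕ) (r : ℝ) : ℝ :=
  Real.log (r * Real.log n)

/-- The quantity `n / (r log n)` that measures, up to powers of `logFactor n r`, the number of hubs
of a node. -/
noncomputable def hubScale (n : ℕ) (r : ℝ) : ℝ :=
  n / (r * Real.log n)

theorem natCast_le_two_pow_natCeil {m : ℕ} {y : ℝ} (hm : m ≤ Real.exp y) :
    m ≤ 2 ^ ⌈2 * y⌉₊ := by
  have hlog : y ≤ ⌈2 * y⌉₊ * Real.log 2 := by
    nlinarith [Nat.le_ceil (2 * y), Real.log_two_gt_d9, Nat.cast_nonneg (α := ℝ) ⌈2 * y⌉₊]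
  rw [← Nat.cast_le (α := ℝ), Nat.cast_pow, Nat.cast_ofNat]
  refine hm.trans ((Real.exp_le_exp.2 hlog).trans_eq ?_)
  rw [mul_comm, Real.exp_mul, Real.exp_log two_pos, Real.rpow_natCast]

theorem div_four_le_natFloor_div_two {r : ℝ} (hr : 2 ≤ r) : r / 4 ≤ ⌊r / 2⌋₊ := by
  have := Nat.div_two_lt_floor (show 1 ≤ r / 2 by linarith)
  linarith

theorem natFloor_div_two_lt {n : ℕ} {r : ℝ} (hr : 2 ≤ r) (hrn : r ≤ n) : ⌊r / 2⌋₊ < n := by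
  have hlt : (⌊r / 2⌋₊ : ℝ) < n := (Nat.floor_le (by linarith)).trans_lt (by linarith)
  exact_mod_cast hlt

variable {n : ℕ} {r : ℝ} (hn : 2 ≤ n) (hr : 2 ≤ r)

include hn

theorem lt_log_natCast_of_two_le : 0.69 < Real.log n := by
  have hle : Real.log 2 ≤ Real.log n := Real.log_le_log two_pos (by exact_mod_cast hn)
  linarith [Real.log_two_gt_d9]

include hr

theorem lt_mul_log_natCast : 1.38 < r * Real.log n := by
  nlinarith [lt_log_natCast_of_two_le hn]

theorem exp_logFactor : Real.exp (logFactor n r) = r * Real.log n :=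
  Real.exp_log (by linarith [lt_mul_log_natCast hn hr])

theorem one_div_four_le_logFactor : 1 / 4 ≤ logFactor n r := by
  have hw := lt_mul_log_natCast hn hr
  have hinv : (r * Real.log n)⁻¹ ≤ 3 / 4 :=
    (inv_anti₀ (by norm_num) hw.le).trans (by norm_num)
  have hlog : 1 - (r * Real.log n)⁻¹ ≤ logFactor n r :=
    Real.one_sub_inv_le_log_of_pos (by linarith)
  linarith

theorem hubScale_mul_mul_log : hubScale n r * (r * Real.log n) = n :=
  div_mul_cancel₀ _ (by linarith [lt_mul_log_natCast hn hr])

theorem hubScale_eq_exp : hubScale n r = Real.exp (Real.log n - logFactor n r) := by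
  rw [Real.exp_sub, exp_logFactor hn hr, Real.exp_log (by positivity), hubScale]

theorem hubScale_pos : 0 < hubScale n r := by
  rw [hubScale_eq_exp hn hr]
  exact Real.exp_pos _

theorem one_le_hubScale (h : 8 * logFactor n r ≤ Real.log n) : 1 ≤ hubScale n r := by
  rw [hubScale_eq_exp hn hr, Real.one_le_exp_iff]
  linarith [one_div_four_le_logFactor hn hr]

theorem one_div_log_le_hubScale (hrn : r ≤ n) : 1 / Real.log n ≤ hubScale n r := by
  have hL := lt_log_natCast_of_two_le hn
  rw [hubScale, ← div_div]
  gcongr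
  rwa [one_le_div (by linarith)]

theorem one_le_hubScale_mul_logFactor_sq (hrn : r ≤ n) :
    1 ≤ 32 * (hubScale n r * logFactor n r ^ 2) := by
  have hlam := one_div_four_le_logFactor hn hr
  have hL := lt_log_natCast_of_two_le hn
  obtain h | h := le_or_gt (8 * logFactor n r) (Real.log n)
  · nlinarith [one_le_hubScale hn hr h]
  · have hβ := one_div_log_le_hubScale hn hr hrn
    calc 1 ≤ 32 * (1 / Real.log n * logFactor n r ^ 2) := by
          field_simp
          nlinarith
      _ ≤ _ := by gcongr

theorem log_le_hubScale_mul_logFactor_sq (hrn : r ≤ n) :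
    Real.log n ≤ 64 * (hubScale n r * logFactor n r ^ 2) := by
  have hlam := one_div_four_le_logFactor hn hr
  have hL := lt_log_natCast_of_two_le hn
  obtain h | h := le_or_gt (8 * logFactor n r) (Real.log n)
  · have hβ : 1 + (Real.log n - logFactor n r) ≤ hubScale n r := by
      rw [hubScale_eq_exp hn hr, add_comm]
      exact Real.add_one_le_exp _
    have hβlam : hubScale n r ≤ 16 * (hubScale n r * logFactor n r ^ 2) := by
      nlinarith [mul_le_mul hlam hlam (by norm_num) (by linarith), hubScale_pos hn hr]
    linarith
  · have hβ := one_div_log_le_hubScale hn hr hrn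
    calc Real.log n ≤ 64 * (1 / Real.log n * logFactor n r ^ 2) := by
          field_simp
          nlinarith
      _ ≤ _ := by gcongr

theorem two_mul_mul_log_div_le {j k q : ℕ} (hj : Real.log n / (16 * logFactor n r) ≤ j)
    (hk : 128 * (hubScale n r * logFactor n r ^ 2) ≤ k) (hq : hubScale n r ≤ q) :
    2 * n * Real.log (n / q) ≤ k * (j * ⌊r / 2⌋₊ : ℕ) := by
  have hlam := one_div_four_le_logFactor hn hr
  have hL := lt_log_natCast_of_two_le hn
  have hβ := hubScale_pos hn hr
  have hρ := div_four_le_natFloor_div_two hr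
  have hlog : Real.log (n / q) ≤ logFactor n r := by
    refine Real.log_le_log (div_pos (by positivity) (hβ.trans_le hq)) ?_
    rw [div_le_iff₀' (hβ.trans_le hq)]
    calc (n : ℝ) = hubScale n r * (r * Real.log n) := (hubScale_mul_mul_log hn hr).symm
      _ ≤ q * (r * Real.log n) := by gcongr
  calc 2 * n * Real.log (n / q) ≤ 2 * n * logFactor n r := by gcongr
    _ = 128 * (hubScale n r * logFactor n r ^ 2) *
          (Real.log n / (16 * logFactor n r) * (r / 4)) := by
        nth_rw 1 [← hubScale_mul_mul_log hn hr]
        field_simp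
        norm_num
    _ ≤ k * (j * ⌊r / 2⌋₊ : ℕ) := by
        push_cast
        gcongr

theorem natCeil_sq_pow_le_hubScale (h : 8 * logFactor n r ≤ Real.log n) {j : ℕ}
    (hj : j ≤ Real.log n / (8 * logFactor n r)) :
    (⌈(r * Real.log n) ^ 2⌉₊ : ℝ) ^ j ≤ hubScale n r := by
  have hlam := one_div_four_le_logFactor hn hr
  have hw := lt_mul_log_natCast hn hr
  have hceil : (⌈(r * Real.log n) ^ 2⌉₊ : ℝ) ≤ Real.exp (4 * logFactor n r) := by
    have hlt := Nat.ceil_lt_add_one (sq_nonneg (r * Real.log n))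
    have hexp : Real.exp (4 * logFactor n r) = (r * Real.log n) ^ 4 := by
      rw [← exp_logFactor hn hr, ← Real.exp_nat_mul, Nat.cast_ofNat]
    have hsq : 1.9 ≤ (r * Real.log n) ^ 2 := by nlinarith
    rw [hexp]
    nlinarith
  rw [le_div_iff₀ (by linarith)] at hj
  calc (⌈(r * Real.log n) ^ 2⌉₊ : ℝ) ^ j ≤ Real.exp (4 * logFactor n r) ^ j := by gcongr
    _ = Real.exp (j * (4 * logFactor n r)) := (Real.exp_nat_mul _ _).symm
    _ ≤ Real.exp (Real.log n - logFactor n r) := Real.exp_le_exp.2 (by linarith)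
    _ = hubScale n r := (hubScale_eq_exp hn hr).symm

end Parameters

section HubLabelings

open SimpleGraph Finset

variable {V : Type*} [Fintype V] {G : SimpleGraph V} {r : ℝ}

theorem exists_isHubFamily_of_logFactor_le (hG : G.Connected) (hn : 2 ≤ Fintype.card V)
    (hr : 2 ≤ r) (h : 8 * logFactor (Fintype.card V) r ≤ Real.log (Fintype.card V)) :
    ∃ Y, IsHubFamily G (2 * ⌊r / 2⌋₊) Y ∧
      ∀ u, #(Y u) ≤ 272 * (hubScale (Fintype.card V) r * logFactor (Fintype.card V) r ^ 2) := by
  set n := Fintype.card V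
  set lam := logFactor n r
  set β := hubScale n r
  set w := r * Real.log n
  have hlam : 1 / 4 ≤ lam := one_div_four_le_logFactor hn hr
  have hL := lt_log_natCast_of_two_le hn
  have hβ : 1 ≤ β := one_le_hubScale hn hr h
  have hβw : β * w = n := hubScale_mul_mul_log hn hr
  let x := Real.log n / (8 * lam)
  have hx : 1 ≤ x := by rwa [one_le_div (by positivity)]
  have hj : Real.log n / (16 * lam) ≤ ⌊x⌋₊ := by
    refine le_trans (le_of_eq ?_) (Nat.div_two_lt_floor hx).le
    simp only [x]
    ring
  have hball : n * Real.log n < ⌈β⌉₊ * ⌈w ^ 2⌉₊ :=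
    calc n * Real.log n < n * w := by
          gcongr
          nlinarith
      _ = β * w ^ 2 := by rw [← hβw]; ring
      _ ≤ ⌈β⌉₊ * ⌈w ^ 2⌉₊ := by gcongr <;> exact Nat.le_ceil _
  obtain ⟨Y, hY, hcard⟩ := exists_isHubFamily hG (Nat.ceil_pos.2 (zero_lt_one.trans_le hβ)) hball
    (two_mul_mul_log_div_le hn hr hj (Nat.le_ceil _) (Nat.le_ceil _))
  refine ⟨Y, hY, fun u ↦ (Nat.cast_le.2 (hcard u)).trans ?_⟩
  have hpow : (⌈w ^ 2⌉₊ : ℝ) ^ ⌊x⌋₊ ≤ β :=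
    natCeil_sq_pow_le_hubScale hn hr h (Nat.floor_le (by positivity))
  have hq := Nat.ceil_lt_add_one (zero_le_one.trans hβ)
  have hk := Nat.ceil_lt_add_one (show 0 ≤ 128 * (β * lam ^ 2) by positivity)
  push_cast
  nlinarith [mul_le_mul hlam hlam (by norm_num) (by linarith)]

theorem exists_isHubFamily_of_lt_logFactor (hG : G.Connected) (hn : 2 ≤ Fintype.card V)
    (hr : 2 ≤ r) (hrn : r ≤ Fintype.card V)
    (h : Real.log (Fintype.card V) < 8 * logFactor (Fintype.card V) r) :
    ∃ Y, IsHubFamily G (2 * ⌊r / 2⌋₊) Y ∧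
      ∀ u, #(Y u) ≤ 160 * (hubScale (Fintype.card V) r * logFactor (Fintype.card V) r ^ 2) := by
  set n := Fintype.card V
  set lam := logFactor n r
  set β := hubScale n r
  have hL := lt_log_natCast_of_two_le hn
  have hβ : 0 < β := hubScale_pos hn hr
  have hβw : β * (r * Real.log n) = n := hubScale_mul_mul_log hn hr
  let x := 2 * (β * Real.log n ^ 2)
  have hball : n * Real.log n < ⌈x⌉₊ * (⌊r / 2⌋₊ + 1 : ℕ) :=
    calc n * Real.log n = β * (r * Real.log n) * Real.log n := by rw [hβw]
      _ = x * (r / 2) := by simp only [x]; ring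
      _ < ⌈x⌉₊ * (⌊r / 2⌋₊ + 1 : ℕ) := by
        push_cast
        exact mul_lt_mul' (Nat.le_ceil x) (Nat.lt_floor_add_one _) (by positivity)
          (Nat.cast_pos.2 (Nat.ceil_pos.2 (by positivity)))
  obtain ⟨Y, hY, hcard⟩ := exists_isHubFamily_of_lt_mul hG (natFloor_div_two_lt hr hrn) hball
  refine ⟨Y, hY, fun u ↦ (Nat.cast_le.2 (hcard u)).trans ?_⟩
  calc (⌈x⌉₊ : ℝ) ≤ 2 * (β * Real.log n ^ 2) + 1 :=
        (Nat.ceil_lt_add_one (by positivity)).le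
    _ ≤ 2 * (β * (8 * lam) ^ 2) + 32 * (β * lam ^ 2) := by
        gcongr
        exact one_le_hubScale_mul_logFactor_sq hn hr hrn
    _ = 160 * (β * lam ^ 2) := by ring

theorem exists_isHubFamily_card_le (hG : G.Connected) (hn : 2 ≤ Fintype.card V) (hr : 2 ≤ r)
    (hrn : r ≤ Fintype.card V) :
    ∃ Y, IsHubFamily G (2 * ⌊r / 2⌋₊) Y ∧
      ∀ u, #(Y u) ≤
        ⌊272 * (hubScale (Fintype.card V) r * logFactor (Fintype.card V) r ^ 2)⌋₊ := by
  obtain h | h := le_or_gt (8 * logFactor (Fintype.card V) r) (Real.log (Fintype.card V))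
  · obtain ⟨Y, hY, hcard⟩ := exists_isHubFamily_of_logFactor_le hG hn hr h
    exact ⟨Y, hY, fun u ↦ Nat.le_floor (hcard u)⟩
  · obtain ⟨Y, hY, hcard⟩ := exists_isHubFamily_of_lt_logFactor hG hn hr hrn h
    have := hubScale_pos hn hr
    exact ⟨Y, hY, fun u ↦ Nat.le_floor ((hcard u).trans (by gcongr; norm_num))⟩

theorem card_hubCodes_mul_le_exp {n : ℕ} (hn : 2 ≤ n) (hr : 2 ≤ r) (hrn : r ≤ n) :
    (#(hubCodes n ⌊272 * (hubScale n r * logFactor n r ^ 2)⌋₊) * n : ℝ) ≤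
      Real.exp (1440 * (hubScale n r * logFactor n r ^ 3)) := by
  set lam := logFactor n r
  set β := hubScale n r
  set s := ⌊272 * (β * lam ^ 2)⌋₊
  have hlam : 1 / 4 ≤ lam := one_div_four_le_logFactor hn hr
  have hβ : 0 < β := hubScale_pos hn hr
  have hs : (s : ℝ) ≤ 272 * (β * lam ^ 2) := Nat.floor_le (by positivity)
  have hL : Real.log n ≤ 64 * (β * lam ^ 2) := log_le_hubScale_mul_logFactor_sq hn hr hrn
  have hlog : 2 * s * lam + 10 * β + Real.log n ≤ 1440 * (β * lam ^ 3) := by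
    have hscode : 2 * s * lam ≤ 544 * (β * lam ^ 3) := by
      linear_combination 2 * lam * hs
    have hβlam : β ≤ 64 * (β * lam ^ 3) := by
      have := pow_le_pow_left₀ (by norm_num) hlam 3
      nlinarith
    have hLlam : Real.log n ≤ 256 * (β * lam ^ 3) := by
      have : 0 ≤ β * lam ^ 2 := by positivity
      nlinarith
    linarith
  have hcodes : (#(hubCodes n s) : ℝ) ≤ Real.exp (2 * s * lam + 10 * β) := by
    have h := card_hubCodes_le n s (by linarith [lt_mul_log_natCast hn hr] : 1 ≤ r * Real.log n)
    rwa [← exp_logFactor hn hr, ← Real.exp_nat_mul, exp_logFactor hn hr, ← Real.exp_add,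
      mul_div_assoc, Nat.cast_mul, Nat.cast_ofNat] at h
  calc (#(hubCodes n s) * n : ℝ)
      ≤ Real.exp (2 * s * lam + 10 * β) * Real.exp (Real.log n) := by
        rw [Real.exp_log (by positivity)]
        gcongr
    _ ≤ Real.exp (1440 * (β * lam ^ 3)) := by
        rw [← Real.exp_add]
        exact Real.exp_le_exp.2 hlog

theorem exists_isDistLabeling_hubCodes [DecidableEq V] (G : SimpleGraph V)
    (hn : 2 ≤ Fintype.card V) (hr : 2 ≤ r) (hrn : r ≤ Fintype.card V) :
    ∃ e : V → (Finset ℕ × Finset ℕ) × V,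
      (∀ u, e u ∈ hubCodes (Fintype.card V)
        ⌊272 * (hubScale (Fintype.card V) r * logFactor (Fintype.card V) r ^ 2)⌋₊ ×ˢ univ) ∧
      IsDistLabeling G (2 * ⌊r / 2⌋₊)
        (fun p q ↦ if p.2 = q.2 then hubDec p.1 q.1 else ⊤) e := by
  have : Nonempty V := Fintype.card_pos_iff.1 (zero_lt_two.trans_le hn)
  have hG := joinComponents_connected G
  obtain ⟨Y, hY, hcard⟩ := exists_isHubFamily_card_le hG hn hr hrn
  obtain ⟨e, he, hdec⟩ := hY.exists_isDistLabeling hG hcard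
  exact ⟨_, fun u ↦ mem_product.2 ⟨he u, mem_univ _⟩, isDistLabeling_componentRep hdec⟩

theorem LabelingScheme.exists_isAdditive_univ {n : ℕ} (hn : 2 ≤ n) (hr : 2 ≤ r) (hrn : r ≤ n) :
    ∃ S : LabelingScheme n, S.IsAdditive r Set.univ ∧
      S.SizeLE (3008 * (hubScale n r * logFactor n r ^ 3)) Set.univ := by
  have hlam := one_div_four_le_logFactor hn hr
  have hβ := hubScale_pos hn hr
  have hcard : #(hubCodes n ⌊272 * (hubScale n r * logFactor n r ^ 2)⌋₊ ×ˢ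
      (univ : Finset (Fin n))) ≤ 2 ^ ⌈2 * (1440 * (hubScale n r * logFactor n r ^ 3))⌉₊ :=
    natCast_le_two_pow_natCeil (by simpa using card_hubCodes_mul_le_exp hn hr hrn)
  refine exists_isAdditive_sizeLE hcard ?_ ?_ fun G _ ↦ by
    simpa only [Fintype.card_fin] using
      exists_isDistLabeling_hubCodes G (by simpa using hn) hr (by simpa using hrn)
  · have hone := one_le_hubScale_mul_logFactor_sq hn hr hrn
    calc (⌈2 * (1440 * (hubScale n r * logFactor n r ^ 3))⌉₊ : ℝ)
        ≤ 2 * (1440 * (hubScale n r * logFactor n r ^ 3)) + 1 :=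
          (Nat.ceil_lt_add_one (by positivity)).le
      _ ≤ 3008 * (hubScale n r * logFactor n r ^ 3) := by
          have : 0 ≤ hubScale n r * logFactor n r ^ 2 := by positivity
          nlinarith
  · push_cast
    linarith [Nat.floor_le (show 0 ≤ r / 2 by linarith)]

end HubLabelings

theorem theorem2 :
    ∃ (C : ℝ) (k : ℕ), ∀ (n : ℕ) (r : ℝ), 2 ≤ n → 2 ≤ r →
      (r ≤ n → ∃ S : LabelingScheme n,
        S.IsAdditive r Set.univ ∧
        S.SizeLE (C * ((n / r) * (Real.log (r * Real.log n) ^ k / Real.log n))) Set.univ) ∧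
      (∃ S : LabelingScheme n,
        S.IsAdditive r {G | G.Connected} ∧
        S.SizeLE (C * ((n / r) * (Real.log (r * Real.log n) ^ k / Real.log n)))
          {G | G.Connected}) := by
  refine ⟨3008, 3, fun n r hn hr ↦ ?_⟩
  have hsize : n / r * (Real.log (r * Real.log n) ^ 3 / Real.log n) =
      hubScale n r * logFactor n r ^ 3 := by
    rw [hubScale, logFactor, div_mul_div_comm, div_mul_eq_mul_div]
  rw [hsize]
  refine ⟨fun hrn ↦ LabelingScheme.exists_isAdditive_univ hn hr hrn, ?_⟩
  obtain hrn | hnr := le_total r n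
  · obtain ⟨S, hadd, hle⟩ := LabelingScheme.exists_isAdditive_univ hn hr hrn
    exact ⟨S, fun G _ ↦ hadd G trivial, fun G _ ↦ hle G trivial⟩
  · have hβ := hubScale_pos hn hr
    have hlam := one_div_four_le_logFactor hn hr
    exact LabelingScheme.exists_isAdditive_connected_of_le hnr (by positivity)
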